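/- Let $R$ be a commutative ring with unity; all modules are unital $R$-modules. Definitions. A finitely generated ideal $J$ of $R$ is a $GV$-ideal if the natural map $R\to \mathrm{Hom}_R(J,R)$, $r\mapsto (x\mapsto rx)$, is an isomorphism. A module $M$ is a $w$-module if the only $x\in M$ with $Jx=0$ for some $GV$-ideal $J$ is $x=0$, and $\mathrm{Ext}^1_R(R/J,M)=0$ for every $GV$-ideal $J$. A $w$-ideal is an ideal that is a $w$-module, and a maximal $w$-ideal is a maximal element of the set of proper $w$-ideals (such ideals are prime). The ring $R$ is a $DW$-ring if every ideal of $R$ is a $w$-ideal, and it is coherent if every finitely generated ideal is finitely presented. A sequence $0\to A\to B\to C\to 0$ is $w$-exact if it is exact after localization at every maximal $w$-ideal. A module $A$ is absolutely pure if, whenever $A$ is a submodule of a module $B$, the map $A\otimes_R M\to B\otimes_R M$ is injective for every module $M$; it is absolutely $w$-pure if, whenever $A$ is a submodule of a module $B$, the sequence $0\to A\to B\to B/A\to 0$ is $w$-exact and so is $0\to A\otimes_R M\to B\otimes_R M\to (B/A)\otimes_R M\to 0$ for every module $M$. A module $M$ is $FP$-projective (resp. $w$-$FP$-projective) if $\mathrm{Ext}^1_R(M,A)=0$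 for every absolutely pure (resp. absolutely $w$-pure) module $A$. The ring $R$ is $FP$-hereditary if every ideal of $R$ is $FP$-projective. The $w$-$FP$-projective dimension $w\text{-}\mathrm{fpd}_R(M)$ of a module $M$ is the smallest integer $n\ge 0$ such that $\mathrm{Ext}^{n+1}_R(M,A)=0$ for every absolutely $w$-pure module $A$, and $\infty$ if there is no such $n$. Finally, $w\text{-}\mathrm{fpD}(R)$ is the supremum of $w\text{-}\mathrm{fpd}_R(M)$ over all finitely generated $R$-modules $M$. Proposition. The following are equivalent: 1. $w\text{-}\mathrm{fpD}(R)\le 1$; 2. every submodule of a $w$-$FP$-projective $R$-module is $w$-$FP$-projective; 3. every submodule of a projective $R$-module is $w$-$FP$-projective; 4. every ideal $I$ of $R$ is $w$-$FP$-projective; 5. $\mathrm{id}_R(A)\le 1$ for every absolutely $w$-pure $R$-module $A$; 6. $R$ is an $FP$-hereditary $DW$-ring; 7. $R$ is a coherent $FP$-hereditary $DW$-ring. -/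

import Mathlib

open CategoryTheory CategoryTheory.Abelian

universe u

namespace WFP

variable (R : Type u) [CommRing R]

/-- Vanishing of `Ext_R^n(M, N)`. -/
def ExtVanishes (M N : Type u) [AddCommGroup M] [Module R M] [AddCommGroup N] [Module R N]
    (n : ℕ) : Prop :=
  Subsingleton (Ext.{u} (ModuleCat.of R M) (ModuleCat.of R N) n)

variable {R}

/-- `J` is a Glaz-Vasconcelos ideal: `J` is finitely generated and the natural map
`R → Hom_R(J, R)`, `r ↦ (x ↦ r x)`, is an isomorphism. -/
def IsGVIdeal (J : Ideal R) : Prop :=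
  J.FG ∧ Function.Bijective (LinearMap.toSpanSingleton R (J →ₗ[R] R) J.subtype)

variable (R)

/-- The set `tor_GV(M) = {x ∈ M | J x = 0 for some GV-ideal J}`. -/
def torGV (M : Type u) [AddCommGroup M] [Module R M] : Set M :=
  {x | ∃ J : Ideal R, IsGVIdeal J ∧ ∀ j ∈ J, j • x = 0}

/-- `M` is GV-torsion-free: `tor_GV(M) = 0`. -/
def IsGVTorsionFree (M : Type u) [AddCommGroup M] [Module R M] : Prop :=
  torGV R M = {0}

/-- `M` is a `w`-module: it is GV-torsion-free and `Ext_R^1(R/J, M) = 0` for every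
GV-ideal `J`. -/
def IsWModule (M : Type u) [AddCommGroup M] [Module R M] : Prop :=
  IsGVTorsionFree R M ∧ ∀ J : Ideal R, IsGVIdeal J → ExtVanishes R (R ⧸ J) M 1

variable {R}

/-- An ideal is a `w`-ideal if it is a `w`-module. -/
def IsWIdeal (I : Ideal R) : Prop := IsWModule R I

/-- `p` is a maximal `w`-ideal: a maximal element of the set of proper `w`-ideals. -/
def IsMaximalWIdeal (p : Ideal R) : Prop :=
  Maximal (fun I : Ideal R => I ≠ ⊤ ∧ IsWIdeal I) p

variable (R)

/-- `R` is a DW-ring: every ideal is a `w`-ideal. -/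
def IsDWRing : Prop := ∀ I : Ideal R, IsWIdeal I

/-- `R` is coherent: every finitely generated ideal is finitely presented. -/
def IsCoherentRing : Prop := ∀ I : Ideal R, I.FG → Module.FinitePresentation R I

section Sequences

variable {R}
variable {A B C : Type u} [AddCommGroup A] [Module R A] [AddCommGroup B] [Module R B]
  [AddCommGroup C] [Module R C]

/-- The sequence `0 → A → B → C → 0` is `w`-exact: it becomes exact after localization at every
maximal `w`-ideal `p`. Every maximal `w`-ideal is prime; the primality
binder is there only so that the localization at `p` can be formed. -/
def IsWExact (f : A →ₗ[R] B) (g : B →ₗ[R] C) : Prop :=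
  ∀ (p : Ideal R) [p.IsPrime], IsMaximalWIdeal p →
    Function.Injective (LocalizedModule.map p.primeCompl f) ∧
    Function.Exact (LocalizedModule.map p.primeCompl f) (LocalizedModule.map p.primeCompl g) ∧
    Function.Surjective (LocalizedModule.map p.primeCompl g)

/-- The sequence `0 → A → B → C → 0` is `w`-pure exact: it is `w`-exact, and it stays `w`-exact
after tensoring with any module. -/
def IsWPureExact (f : A →ₗ[R] B) (g : B →ₗ[R] C) : Prop :=
  IsWExact f g ∧
    ∀ (M : Type u) [AddCommGroup M] [Module R M], IsWExact (f.rTensor M) (g.rTensor M)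

/-- The submodule `N` of `B` is pure: `N ⊗ M → B ⊗ M` is injective for every module `M`. -/
def IsPureSubmodule (N : Submodule R B) : Prop :=
  ∀ (M : Type u) [AddCommGroup M] [Module R M], Function.Injective (N.subtype.rTensor M)

/-- The submodule `N` of `B` is `w`-pure: `0 → N → B → B/N → 0` is `w`-pure exact. -/
def IsWPureSubmodule (N : Submodule R B) : Prop :=
  IsWPureExact N.subtype N.mkQ

end Sequences

/-- `A` is absolutely pure: it is pure in every module containing it. (A module containing `A` is
given by an injective linear map out of `A`.) -/
def IsAbsolutelyPure (A : Type u) [AddCommGroup A] [Module R A] : Prop :=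
  ∀ (B : Type u) [AddCommGroup B] [Module R B] (f : A →ₗ[R] B), Function.Injective f →
    IsPureSubmodule (LinearMap.range f)

/-- `A` is absolutely `w`-pure: it is `w`-pure in every module containing it. -/
def IsAbsolutelyWPure (A : Type u) [AddCommGroup A] [Module R A] : Prop :=
  ∀ (B : Type u) [AddCommGroup B] [Module R B] (f : A →ₗ[R] B), Function.Injective f →
    IsWPureSubmodule (LinearMap.range f)

/-- `M` is FP-projective: `Ext_R^1(M, A) = 0` for every absolutely pure `A`. -/
def IsFPProjective (M : Type u) [AddCommGroup M] [Module R M] : Prop :=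
  ∀ (A : Type u) [AddCommGroup A] [Module R A], IsAbsolutelyPure R A → ExtVanishes R M A 1

/-- `M` is `w`-FP-projective: `Ext_R^1(M, A) = 0` for every absolutely `w`-pure `A`. -/
def IsWFPProjective (M : Type u) [AddCommGroup M] [Module R M] : Prop :=
  ∀ (A : Type u) [AddCommGroup A] [Module R A], IsAbsolutelyWPure R A → ExtVanishes R M A 1

/-- `R` is FP-hereditary: every ideal is FP-projective. -/
def IsFPHereditary : Prop := ∀ I : Ideal R, IsFPProjective R I

/-- The `w`-FP-projective dimension of `M`: the smallest `n ≥ 0` such that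
`Ext_R^{n+1}(M, A) = 0` for every absolutely `w`-pure `A`, and `∞` if there is none. -/
noncomputable def wfpd (M : Type u) [AddCommGroup M] [Module R M] : ℕ∞ :=
  sInf {d : ℕ∞ | ∃ n : ℕ, d = n ∧
    ∀ (A : Type u) [AddCommGroup A] [Module R A],
      IsAbsolutelyWPure R A → ExtVanishes R M A (n + 1)}

/-- The `w`-FP-projective dimension of `R`: the supremum of the `w`-FP-projective dimensions of
the finitely generated modules. -/
noncomputable def wfpD : ℕ∞ :=
  ⨆ (M : ModuleCat.{u} R) (_ : Module.Finite R M), wfpd R M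

end WFP

/-!
A finite FP-projective module `M = F / K`, with `F` finite free, is finitely presented. Write `K` as
the directed union of its finitely generated submodules `S i` and embed each `F / S i` in an
injective `E i`. The families in `∏ E i` that vanish eventually form a pure submodule of an
injective module, hence an absolutely pure module, and the canonical map from `K` to it extends to
`F`. As `F` is finite, the extension has all its values in the families vanishing on a common
eventual set, so `K ≤ S i` for some `i`.

A module killed by a GV-ideal `J` vanishes at every maximal `w`-ideal, hence is absolutely
`w`-pure. If `J` is `w`-FP-projective, it is finitely presented by the first fact, so in
`0 → K → Rⁿ → J → 0` the module `K` is finite and `K → K / JK` extends to `Rⁿ`. By Cayley–Hamilton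
some `c ∈ 1 + J` then acts on `J` through `Rⁿ`. Since every map `J → R` is multiplication by a
scalar, this forces `c ∈ J`, so `J = R`. A ring without proper GV-ideals is a DW-ring.

Everything else is dimension shifting, with Baer's criterion reducing injective dimension to the
vanishing of `Ext` on the cyclic modules `R / I`.
-/

namespace WFP

section AbelianCategory

universe w

variable {C : Type*} [Category C] [Abelian C] [HasExt.{w} C] {n : ℕ}

lemma subsingleton_ext_of_retract {X X' : C} (r : Retract X X') {Y : C}
    (h : Subsingleton (Ext X' Y n)) : Subsingleton (Ext X Y n) :=
  subsingleton_of_forall_eq 0 fun x ↦ by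
    rw [← Ext.mk₀_id_comp x, ← r.retract, ← Ext.mk₀_comp_mk₀_assoc,
      Subsingleton.elim ((Ext.mk₀ r.r).comp x (zero_add n)) 0, Ext.comp_zero]

variable {S : ShortComplex C} (hS : S.ShortExact) {Y : C}
include hS

lemma subsingleton_ext_X₁ (h₂ : Subsingleton (Ext S.X₂ Y n))
    (h₃ : Subsingleton (Ext S.X₃ Y (n + 1))) : Subsingleton (Ext S.X₁ Y n) :=
  subsingleton_of_forall_eq 0 fun x ↦ by
    obtain ⟨y, rfl⟩ :=
      Ext.contravariant_sequence_exact₁ hS Y x (add_comm 1 n) (Subsingleton.elim _ _)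
    rw [Subsingleton.elim y 0, Ext.comp_zero]

lemma subsingleton_ext_X₃ (h₂ : Subsingleton (Ext S.X₂ Y (n + 1)))
    (h₁ : Subsingleton (Ext S.X₁ Y n)) : Subsingleton (Ext S.X₃ Y (n + 1)) :=
  subsingleton_of_forall_eq 0 fun x ↦ by
    obtain ⟨y, rfl⟩ :=
      Ext.contravariant_sequence_exact₃ hS Y x (Subsingleton.elim _ _) (add_comm 1 n)
    rw [Subsingleton.elim y 0, Ext.comp_zero]

lemma subsingleton_ext_to_X₃ (h₂ : Subsingleton (Ext Y S.X₂ n))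
    (h₁ : Subsingleton (Ext Y S.X₁ (n + 1))) : Subsingleton (Ext Y S.X₃ n) :=
  subsingleton_of_forall_eq 0 fun x ↦ by
    obtain ⟨y, rfl⟩ := Ext.covariant_sequence_exact₃ Y hS x rfl (Subsingleton.elim _ _)
    rw [Subsingleton.elim y 0, Ext.zero_comp]

lemma exists_f_comp_eq_of_subsingleton_ext (h₃ : Subsingleton (Ext S.X₃ Y 1)) (φ : S.X₁ ⟶ Y) :
    ∃ ψ : S.X₂ ⟶ Y, S.f ≫ ψ = φ := by
  obtain ⟨y, hy⟩ := Ext.contravariant_sequence_exact₁ hS Y (Ext.mk₀ φ) (add_zero 1)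
    (Subsingleton.elim _ _)
  obtain ⟨ψ, rfl⟩ := (Ext.mk₀_bijective _ _).surjective y
  rw [Ext.mk₀_comp_mk₀] at hy
  exact ⟨ψ, (Ext.mk₀_bijective _ _).injective hy⟩

end AbelianCategory

section InjectiveDimension

variable {R : Type u} [Ring R]

lemma shortExact_subtype_mkQ {M : Type u} [AddCommGroup M] [Module R M] (N : Submodule R M) :
    (ModuleCat.shortComplexOfCompEqZero N.subtype N.mkQ
      (LinearMap.exact_subtype_mkQ N).linearMap_comp_eq_zero).ShortExact :=
  ModuleCat.shortComplex_shortExact _ (LinearMap.exact_subtype_mkQ N) N.injective_subtype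
    N.mkQ_surjective

lemma exists_injective_linearMap (M : Type u) [AddCommGroup M] [Module R M] :
    ∃ (E : ModuleCat.{u} R) (j : M →ₗ[R] E), Module.Injective R E ∧ Function.Injective j := by
  obtain ⟨E, _, f, _⟩ := EnoughInjectives.presentation (ModuleCat.of R M)
  exact ⟨E, f.hom, Module.injective_module_of_injective_object R E,
    (ModuleCat.mono_iff_injective f).mp ‹_›⟩

lemma injective_of_subsingleton_ext_one {A : ModuleCat.{u} R}
    (h : ∀ I : Ideal R, Subsingleton (Ext (ModuleCat.of R (R ⧸ I)) A 1)) : Injective A :=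
  (Module.injective_iff_injective_object R A).mp <| Module.Baer.injective fun I f ↦ by
    obtain ⟨g, hg⟩ := exists_f_comp_eq_of_subsingleton_ext (shortExact_subtype_mkQ I) (h I)
      (ModuleCat.ofHom f)
    exact ⟨g.hom, fun x hx ↦ congr($hg ⟨x, hx⟩)⟩

lemma hasInjectiveDimensionLE_of_subsingleton_ext {A : ModuleCat.{u} R} {n : ℕ}
    (h : ∀ I : Ideal R, Subsingleton (Ext (ModuleCat.of R (R ⧸ I)) A (n + 1))) :
    HasInjectiveDimensionLE A n := by
  induction n generalizing A with
  | zero => exact injective_iff_hasInjectiveDimensionLT_one.mp (injective_of_subsingleton_ext_one h)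
  | succ n ih =>
    obtain ⟨E, j, hE, hj⟩ := exists_injective_linearMap (R := R) A
    have hS := ModuleCat.shortComplex_shortExact
      (ModuleCat.shortComplexOfCompEqZero _ _ j.exact_map_mkQ_range.linearMap_comp_eq_zero)
      j.exact_map_mkQ_range hj (Submodule.mkQ_surjective _)
    have hinj : Injective E := (Module.injective_iff_injective_object R E).mp hE
    exact (hS.hasInjectiveDimensionLT_X₃_iff n hinj).mp <| ih fun I ↦
      subsingleton_ext_to_X₃ hS (Ext.subsingleton_of_injective _ E n) (h I)

end InjectiveDimension

variable {R : Type u} [CommRing R]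

section Ext

variable {A M : Type u} [AddCommGroup A] [Module R A] [AddCommGroup M] [Module R M] {n : ℕ}

lemma extVanishes_succ_of_projective [Module.Projective R M] : ExtVanishes R M A (n + 1) :=
  Ext.subsingleton_of_projective (ModuleCat.of R M) _ _

lemma extVanishes_of_injectiveDimension_le {m : ℕ}
    (h : injectiveDimension (ModuleCat.of R A) ≤ m) (hmn : m < n) : ExtVanishes R M A n :=
  have := (injectiveDimension_le_iff _ m).mp h
  HasInjectiveDimensionLT.subsingleton (ModuleCat.of R A) (m + 1) n hmn _

lemma ExtVanishes.submodule {N : Submodule R M} (hM : ExtVanishes R M A n)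
    (hQ : ExtVanishes R (M ⧸ N) A (n + 1)) : ExtVanishes R N A n :=
  subsingleton_ext_X₁ (shortExact_subtype_mkQ N) hM hQ

lemma ExtVanishes.quotient {N : Submodule R M} (hM : ExtVanishes R M A (n + 1))
    (hN : ExtVanishes R N A n) : ExtVanishes R (M ⧸ N) A (n + 1) :=
  subsingleton_ext_X₃ (shortExact_subtype_mkQ N) hM hN

lemma ExtVanishes.of_comp_eq_id {N : Type u} [AddCommGroup N] [Module R N]
    (h : ExtVanishes R M A n) {i : N →ₗ[R] M} {r : M →ₗ[R] N} (hri : r ∘ₗ i = .id) :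
    ExtVanishes R N A n :=
  subsingleton_ext_of_retract
    { i := ModuleCat.ofHom i
      r := ModuleCat.ofHom r
      retract := ModuleCat.hom_ext hri } h

lemma ExtVanishes.exists_comp_ker_subtype_eq {N : Type u} [AddCommGroup N] [Module R N]
    (h : ExtVanishes R N A 1) {π : M →ₗ[R] N} (hπ : Function.Surjective π)
    (f : LinearMap.ker π →ₗ[R] A) : ∃ g : M →ₗ[R] A, g ∘ₗ (LinearMap.ker π).subtype = f := by
  obtain ⟨g, hg⟩ := exists_f_comp_eq_of_subsingleton_ext
    (LinearMap.shortExact_shortComplexKer hπ) h (ModuleCat.ofHom f)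
  exact ⟨g.hom, congr(($hg).hom)⟩

end Ext

section Purity

variable {A B : Type u} [AddCommGroup A] [Module R A] [AddCommGroup B] [Module R B]

lemma isPureSubmodule_of_forall_finset_exists_retraction {N : Submodule R B}
    (h : ∀ s : Finset N, ∃ e : B →ₗ[R] N, ∀ a ∈ s, e a = a) : IsPureSubmodule N := by
  classical
  refine fun M _ _ ↦ (injective_iff_map_eq_zero _).mpr fun x hx ↦ ?_
  obtain ⟨s, rfl⟩ := TensorProduct.exists_finset x
  obtain ⟨e, he⟩ := h (s.image Prod.fst)
  calc ∑ i ∈ s, i.1 ⊗ₜ[R] i.2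
      = e.rTensor M (N.subtype.rTensor M (∑ i ∈ s, i.1 ⊗ₜ[R] i.2)) := by
        simp only [map_sum, LinearMap.rTensor_tmul, Submodule.subtype_apply]
        exact Finset.sum_congr rfl fun i hi ↦ by rw [he i.1 (Finset.mem_image_of_mem _ hi)]
    _ = 0 := by rw [hx, map_zero]

lemma IsPureSubmodule.isAbsolutelyPure [Module.Injective R B] {N : Submodule R B}
    (hN : IsPureSubmodule N) : IsAbsolutelyPure R N := by
  intro C _ _ f hf M _ _
  obtain ⟨g, hg⟩ := Module.Injective.extension_property R B N C f hf N.subtype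
  let e := LinearEquiv.ofInjective f hf
  have hge : g ∘ₗ (LinearMap.range f).subtype = N.subtype ∘ₗ e.symm.toLinearMap := by
    rw [LinearEquiv.eq_comp_toLinearMap_symm, ← hg]
    rfl
  have hinj : Function.Injective ((g ∘ₗ (LinearMap.range f).subtype).rTensor M) := by
    rw [hge, LinearMap.rTensor_comp]
    exact (hN M).comp (e.symm.rTensor M).injective
  rw [LinearMap.rTensor_comp] at hinj
  exact Function.Injective.of_comp hinj

/-- The submodule of families that vanish eventually along the filter `l`, i.e. the kernel of the
map from the product of the `E i` to their reduced product modulo `l`. -/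
def eventuallyZero {ι : Type*} (l : Filter ι) (E : ι → Type*) [∀ i, AddCommGroup (E i)]
    [∀ i, Module R (E i)] : Submodule R (∀ i, E i) where
  carrier := {x | ∀ᶠ i in l, x i = 0}
  add_mem' hx hy := by
    filter_upwards [hx, hy] with i hxi hyi
    simp [hxi, hyi]
  zero_mem' := .of_forall fun _ ↦ rfl
  smul_mem' r x hx := by
    filter_upwards [hx] with i hxi
    simp [hxi]

variable {ι : Type u} (l : Filter ι) (E : ι → Type u) [∀ i, AddCommGroup (E i)]
  [∀ i, Module R (E i)]

lemma isPureSubmodule_eventuallyZero : IsPureSubmodule (eventuallyZero (R := R) l E) := by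
  classical
  refine isPureSubmodule_of_forall_finset_exists_retraction fun s ↦ ?_
  have hs : ∀ᶠ i in l, ∀ a ∈ s, a.1 i = 0 := (Filter.eventually_all_finset s).mpr fun a _ ↦ a.2
  let truncate : (∀ i, E i) →ₗ[R] ∀ i, E i :=
    .pi fun i ↦ if ∀ a ∈ s, a.1 i = 0 then 0 else .proj i
  have htruncate (x : ∀ i, E i) (i : ι) :
      truncate x i = if ∀ a ∈ s, a.1 i = 0 then 0 else x i := by
    simp only [truncate, LinearMap.pi_apply]
    split_ifs <;> rfl
  refine ⟨truncate.codRestrict _ fun x ↦ hs.mono fun i hi ↦ by rw [htruncate, if_pos hi],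
    fun a ha ↦ ?_⟩
  ext i
  refine (htruncate a.1 i).trans (ite_eq_right_iff.mpr ?_)
  exact fun hi ↦ (hi a ha).symm

lemma isAbsolutelyPure_eventuallyZero [∀ i, Module.Injective R (E i)] :
    IsAbsolutelyPure R (eventuallyZero (R := R) l E) :=
  (isPureSubmodule_eventuallyZero l E).isAbsolutelyPure

end Purity

section FinitePresentation

variable {F : Type u} [AddCommGroup F] [Module R F] [Module.Finite R F] {K : Submodule R F}

lemma eventually_le_of_forall_exists_extension
    (hK : ∀ (A : Type u) [AddCommGroup A] [Module R A], IsAbsolutelyPure R A →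
      ∀ f : K →ₗ[R] A, ∃ g : F →ₗ[R] A, g ∘ₗ K.subtype = f)
    {ι : Type u} {l : Filter ι} {S : ι → Submodule R F} (hS : ∀ x ∈ K, ∀ᶠ i in l, x ∈ S i) :
    ∀ᶠ i in l, K ≤ S i := by
  choose E j hE hj using fun i ↦ exists_injective_linearMap (R := R) (F ⧸ S i)
  let d : F →ₗ[R] ∀ i, E i := .pi fun i ↦ j i ∘ₗ (S i).mkQ
  have hd (x : F) (i : ι) : d x i = 0 ↔ x ∈ S i := by
    rw [← (S i).ker_mkQ, LinearMap.mem_ker, ← map_eq_zero_iff (j i) (hj i)]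
    rfl
  obtain ⟨g, hg⟩ := hK _ (isAbsolutelyPure_eventuallyZero l fun i ↦ E i)
    ((d ∘ₗ K.subtype).codRestrict _ fun x ↦ (hS x x.2).mono fun i ↦ (hd x i).mpr)
  have hgd (x : F) (hx : x ∈ K) : (g x).1 = d x := congr(($hg ⟨x, hx⟩).1)
  obtain ⟨s, hs⟩ := Module.Finite.fg_top (R := R) (M := F)
  have hgs : ∀ᶠ i in l, ∀ b ∈ s, (g b).1 i = 0 :=
    (Filter.eventually_all_finset s).mpr fun b _ ↦ (g b).2
  filter_upwards [hgs] with i hi x hx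
  have hgi : LinearMap.proj i ∘ₗ Submodule.subtype _ ∘ₗ g = 0 := LinearMap.ext_on hs hi
  rw [← hd, ← hgd x hx]
  exact congr($hgi x)

lemma fg_of_forall_exists_extension
    (hK : ∀ (A : Type u) [AddCommGroup A] [Module R A], IsAbsolutelyPure R A →
      ∀ f : K →ₗ[R] A, ∃ g : F →ₗ[R] A, g ∘ₗ K.subtype = f) : K.FG := by
  classical
  let S (s : Finset K) : Submodule R F := Submodule.span R (s.image Subtype.val)
  have hS : ∀ x ∈ K, ∀ᶠ s in Filter.atTop, x ∈ S s := fun x hx ↦ by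
    filter_upwards [Filter.eventually_ge_atTop {⟨x, hx⟩}] with s hs
    exact Submodule.subset_span (Finset.mem_image_of_mem _ (Finset.singleton_subset_iff.mp hs))
  obtain ⟨s, hs⟩ := (eventually_le_of_forall_exists_extension hK hS).exists
  refine ⟨s.image Subtype.val, le_antisymm (Submodule.span_le.mpr ?_) hs⟩
  simp +contextual [Set.subset_def]

lemma IsFPProjective.finitePresentation {M : Type u} [AddCommGroup M] [Module R M]
    [Module.Finite R M] (hM : IsFPProjective R M) : Module.FinitePresentation R M := by
  obtain ⟨n, π, hπ⟩ := Module.Finite.exists_fin' R M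
  exact Module.finitePresentation_of_surjective π hπ <|
    fg_of_forall_exists_extension fun A _ _ hA ↦ (hM A hA).exists_comp_ker_subtype_eq hπ

lemma IsFPHereditary.isCoherentRing (hR : IsFPHereditary R) : IsCoherentRing R :=
  fun I hI ↦ have := Module.Finite.of_fg hI; (hR I).finitePresentation

end FinitePresentation

section WPurity

variable {A B C : Type u} [AddCommGroup A] [Module R A] [AddCommGroup B] [Module R B]
  [AddCommGroup C] [Module R C]

lemma IsWExact.of_exact {f : A →ₗ[R] B} {g : B →ₗ[R] C} (hf : Function.Injective f)
    (hfg : Function.Exact f g) (hg : Function.Surjective g) : IsWExact f g := fun _ _ _ ↦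
  ⟨LocalizedModule.map_injective _ f hf, LocalizedModule.map_exact _ f g hfg,
    LocalizedModule.map_surjective _ g hg⟩

lemma IsAbsolutelyPure.isAbsolutelyWPure (hA : IsAbsolutelyPure R A) : IsAbsolutelyWPure R A :=
  fun B _ _ f hf ↦
    have hexact := LinearMap.exact_subtype_mkQ (LinearMap.range f)
    have hsurj := (LinearMap.range f).mkQ_surjective
    ⟨.of_exact (Submodule.injective_subtype _) hexact hsurj, fun M _ _ ↦
      .of_exact (hA B f hf M) (rTensor_exact M hexact hsurj) (LinearMap.rTensor_surjective M hsurj)⟩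

lemma IsDWRing.isMaximalWIdeal (hR : IsDWRing R) {p : Ideal R} (hp : p.IsMaximal) :
    IsMaximalWIdeal p :=
  ⟨⟨hp.ne_top, hR p⟩, fun _ hI hpI ↦ (hp.eq_of_le hI.1 hpI).ge⟩

lemma IsDWRing.isAbsolutelyPure (hR : IsDWRing R) (hA : IsAbsolutelyWPure R A) :
    IsAbsolutelyPure R A := fun B _ _ f hf M _ _ ↦
  injective_of_localized_maximal _ fun p hp ↦ ((hA B f hf).2 M p (hR.isMaximalWIdeal hp)).1

lemma IsWFPProjective.isFPProjective (hA : IsWFPProjective R A) : IsFPProjective R A :=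
  fun E _ _ hE ↦ hA E hE.isAbsolutelyWPure

lemma IsDWRing.isWFPProjective (hR : IsDWRing R) (hA : IsFPProjective R A) :
    IsWFPProjective R A :=
  fun E _ _ hE ↦ hA E (hR.isAbsolutelyPure hE)

lemma annihilator_le_annihilator_tensorProduct :
    Module.annihilator R A ≤ Module.annihilator R (TensorProduct R A B) := fun r hr ↦ by
  rw [Module.mem_annihilator_iff_lsmul_eq_zero] at hr ⊢
  ext a b
  have hra : r • a = 0 := congr($hr a)
  simp [TensorProduct.smul_tmul', hra]

end WPurity

section GVIdeal

variable {J : Ideal R}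

lemma isGVIdeal_top : IsGVIdeal (⊤ : Ideal R) := by
  refine ⟨Module.Finite.fg_top, fun r s hrs ↦ by simpa using congr($hrs ⟨1, trivial⟩),
    fun f ↦ ⟨f ⟨1, trivial⟩, LinearMap.ext fun x ↦ ?_⟩⟩
  have hx : x = (x : R) • (⟨1, trivial⟩ : (⊤ : Ideal R)) := by ext; simp
  conv_rhs => rw [hx, map_smul]
  simp [mul_comm]

lemma IsGVIdeal.eq_of_forall_mul_eq (hJ : IsGVIdeal J) {r s : R}
    (h : ∀ x ∈ J, x * r = x * s) : r = s :=
  hJ.2.1 (LinearMap.ext fun x ↦ by simpa [mul_comm] using h x x.2)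

lemma IsGVIdeal.exists_eq_smul (hJ : IsGVIdeal J) {ι : Type*} (f : J →ₗ[R] (ι → R)) :
    ∃ r : ι → R, ∀ x : J, f x = (x : R) • r := by
  choose r hr using fun i ↦ hJ.2.2 (LinearMap.proj i ∘ₗ f)
  exact ⟨r, fun x ↦ funext fun i ↦ by simpa [mul_comm] using congr($(hr i) x).symm⟩

lemma IsGVIdeal.eq_top_of_le (hJ : IsGVIdeal J) {I : Ideal R} (hI : IsWIdeal I) (hle : J ≤ I) :
    I = ⊤ := by
  obtain ⟨g, hg⟩ := exists_f_comp_eq_of_subsingleton_ext (shortExact_subtype_mkQ J) (hI.2 J hJ)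
    (ModuleCat.ofHom (Submodule.inclusion hle))
  have hg1 : (g.hom 1 : R) = 1 := hJ.eq_of_forall_mul_eq fun x hx ↦ by
    have hgx : g.hom x = Submodule.inclusion hle ⟨x, hx⟩ := congr($hg ⟨x, hx⟩)
    rw [← smul_eq_mul, ← Submodule.coe_smul, ← map_smul, smul_eq_mul, mul_one, hgx]
    rfl
  exact (Ideal.eq_top_iff_one I).mpr (hg1 ▸ (g.hom 1).2)

lemma isDWRing_iff_forall_isGVIdeal_eq_top :
    IsDWRing R ↔ ∀ J : Ideal R, IsGVIdeal J → J = ⊤ := by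
  refine ⟨fun hR J hJ ↦ hJ.eq_top_of_le (hR J) le_rfl, fun h I ↦
    ⟨Set.eq_singleton_iff_unique_mem.mpr ⟨⟨⊤, isGVIdeal_top, fun j _ ↦ smul_zero j⟩, ?_⟩,
      fun J hJ ↦ ?_⟩⟩
  · rintro x ⟨J, hJ, hx⟩
    simpa using hx 1 (h J hJ ▸ trivial)
  · have : Subsingleton (R ⧸ J) := Ideal.Quotient.subsingleton_iff.mpr (h J hJ)
    exact extVanishes_succ_of_projective

lemma IsGVIdeal.subsingleton_localizedModule (hJ : IsGVIdeal J) {T : Type u} [AddCommGroup T]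
    [Module R T] (hT : J ≤ Module.annihilator R T) {p : Ideal R} [hp : p.IsPrime]
    (hpw : IsMaximalWIdeal p) : Subsingleton (LocalizedModule p.primeCompl T) :=
  Module.notMem_support_iff (p := ⟨p, hp⟩).mp fun hsupp ↦
    hpw.1.1 (hJ.eq_top_of_le hpw.1.2 (hT.trans (Module.annihilator_le_of_mem_support hsupp)))

lemma IsGVIdeal.isWExact (hJ : IsGVIdeal J) {A B C : Type u} [AddCommGroup A] [Module R A]
    [AddCommGroup B] [Module R B] [AddCommGroup C] [Module R C] {f : A →ₗ[R] B} {g : B →ₗ[R] C}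
    (hA : J ≤ Module.annihilator R A) (hfg : Function.Exact f g) (hg : Function.Surjective g) :
    IsWExact f g := fun _ _ hp ↦
  have := hJ.subsingleton_localizedModule hA hp
  ⟨Function.injective_of_subsingleton _, LocalizedModule.map_exact _ f g hfg,
    LocalizedModule.map_surjective _ g hg⟩

lemma IsGVIdeal.isAbsolutelyWPure (hJ : IsGVIdeal J) {T : Type u} [AddCommGroup T] [Module R T]
    (hT : J ≤ Module.annihilator R T) : IsAbsolutelyWPure R T := fun _ _ _ f _ ↦
  have hexact := LinearMap.exact_subtype_mkQ (LinearMap.range f)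
  have hsurj := (LinearMap.range f).mkQ_surjective
  have hrange : J ≤ Module.annihilator R (LinearMap.range f) :=
    hT.trans (f.rangeRestrict.annihilator_le_of_surjective f.surjective_rangeRestrict)
  ⟨hJ.isWExact hrange hexact hsurj, fun M _ _ ↦
    hJ.isWExact (hrange.trans annihilator_le_annihilator_tensorProduct)
      (rTensor_exact M hexact hsurj) (LinearMap.rTensor_surjective M hsurj)⟩

end GVIdeal

section ScalarFactorization

variable {K P N : Type*} [AddCommGroup K] [Module R K] [AddCommGroup P] [Module R P]
  [AddCommGroup N] [Module R N] (J : Ideal R)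

open Polynomial in
lemma exists_comp_eq_smul_of_sub_mem_smul_top [Module.Finite R K] (φ : Module.End R K)
    (hφ : ∀ x, φ x - x ∈ J • (⊤ : Submodule R K)) :
    ∃ c : R, c - 1 ∈ J ∧ ∃ q : Module.End R K, q ∘ₗ φ = c • LinearMap.id := by
  have hrange : LinearMap.range (1 - φ) ≤ J • ⊤ := by
    rintro _ ⟨x, rfl⟩
    simpa using neg_mem (hφ x)
  obtain ⟨p, hp, -, hcoeff, hroot⟩ :=
    LinearMap.exists_monic_and_natDegree_eq_and_coeff_mem_pow_and_aeval_eq_zero R (1 - φ) J hrange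
  have hp1 : p.eval 1 - 1 ∈ J := by
    simp only [eval_eq_sum_range, Finset.sum_range_succ, hp.coeff_natDegree, one_pow, mul_one,
      add_sub_cancel_right]
    refine Ideal.sum_mem _ fun k hk ↦ Ideal.pow_le_self ?_ (hcoeff k)
    have := Finset.mem_range.mp hk
    lia
  -- `q` is read off `p = (X - 1) q + p(1)`, evaluated at the root `1 - φ` of `p`.
  obtain ⟨q, hq⟩ : X - C 1 ∣ p - C (p.eval 1) := X_sub_C_dvd_sub_C_eval
  have hqφ : -(aeval (1 - φ) q * φ) = -(p.eval 1 • 1) := by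
    simpa [hroot, mul_comm (X - 1 : R[X]), Algebra.algebraMap_eq_smul_one] using
      congr(aeval (1 - φ) $hq).symm
  exact ⟨p.eval 1, hp1, aeval (1 - φ) q, neg_injective hqφ⟩

lemma exists_comp_subtype_eq_smul [Module.Projective R P] {K : Submodule R P} [Module.Finite R K]
    {φ : P →ₗ[R] K ⧸ (J • ⊤ : Submodule R K)}
    (hφ : φ ∘ₗ K.subtype = (J • ⊤ : Submodule R K).mkQ) :
    ∃ c : R, c - 1 ∈ J ∧ ∃ s : P →ₗ[R] K, s ∘ₗ K.subtype = c • LinearMap.id := by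
  obtain ⟨ψ, hψ⟩ := Module.projective_lifting_property (J • ⊤ : Submodule R K).mkQ φ
    (Submodule.mkQ_surjective _)
  have hψ_sub (x : K) : ψ x - x ∈ (J • ⊤ : Submodule R K) := by
    rw [← Submodule.Quotient.eq]
    exact congr($hψ x).trans congr($hφ x)
  obtain ⟨c, hc, q, hq⟩ :=
    exists_comp_eq_smul_of_sub_mem_smul_top J (ψ ∘ₗ K.subtype) hψ_sub
  exact ⟨c, hc, q ∘ₗ ψ, hq⟩

lemma exists_comp_eq_smul_of_comp_ker_subtype_eq_smul {π : P →ₗ[R] N}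
    (hπ : Function.Surjective π) {c : R} {s : P →ₗ[R] LinearMap.ker π}
    (hs : s ∘ₗ (LinearMap.ker π).subtype = c • LinearMap.id) :
    ∃ g : N →ₗ[R] P, π ∘ₗ g = c • LinearMap.id := by
  let χ : P →ₗ[R] P := c • LinearMap.id - (LinearMap.ker π).subtype ∘ₗ s
  have hχ : LinearMap.ker π ≤ LinearMap.ker χ := fun x hx ↦ by
    have hsx : (s x : P) = c • x := congr(($hs ⟨x, hx⟩ : P))
    simp [χ, hsx]
  refine ⟨(LinearMap.ker π).liftQ χ hχ ∘ₗ (π.quotKerEquivOfSurjective hπ).symm, ?_⟩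
  rw [← LinearMap.cancel_right hπ]
  ext x
  have hx : (π.quotKerEquivOfSurjective hπ).symm (π x) = (LinearMap.ker π).mkQ x :=
    (LinearEquiv.symm_apply_eq _).mpr rfl
  simp [hx, χ]

end ScalarFactorization

section DWRing

variable {J : Ideal R}

lemma IsGVIdeal.mem_of_comp_eq_smul (hJ : IsGVIdeal J) {ι : Type*} {π : (ι → R) →ₗ[R] J}
    {g : J →ₗ[R] (ι → R)} {c : R} (h : π ∘ₗ g = c • LinearMap.id) : c ∈ J := by
  obtain ⟨r, hr⟩ := hJ.exists_eq_smul g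
  have hc : c = π r := hJ.eq_of_forall_mul_eq fun x hx ↦ by
    have hx' : π (g ⟨x, hx⟩) = c • ⟨x, hx⟩ := congr($h ⟨x, hx⟩)
    rw [hr, map_smul] at hx'
    simpa [mul_comm x c] using congr(($hx' : R)).symm
  exact hc ▸ (π r).2

lemma IsGVIdeal.eq_top_of_extVanishes (hJ : IsGVIdeal J) [Module.FinitePresentation R J]
    (h : ∀ (T : Type u) [AddCommGroup T] [Module R T], J ≤ Module.annihilator R T →
      ExtVanishes R J T 1) : J = ⊤ := by
  obtain ⟨n, π, hπ⟩ := Module.Finite.exists_fin' R J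
  let K := LinearMap.ker π
  have : Module.Finite R K := .of_fg (Module.FinitePresentation.fg_ker π hπ)
  have hT : J ≤ Module.annihilator R (K ⧸ (J • ⊤ : Submodule R K)) :=
    (Module.isTorsionBySet_iff_subset_annihilator R _).mp
      (Module.isTorsionBySet_quotient_ideal_smul K J)
  obtain ⟨φ, hφ⟩ := (h _ hT).exists_comp_ker_subtype_eq hπ (J • ⊤ : Submodule R K).mkQ
  obtain ⟨c, hc, s, hs⟩ := exists_comp_subtype_eq_smul J hφ
  obtain ⟨g, hg⟩ := exists_comp_eq_smul_of_comp_ker_subtype_eq_smul hπ hs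
  exact (Ideal.eq_top_iff_one J).mpr <|
    (Submodule.sub_mem_iff_right J (hJ.mem_of_comp_eq_smul hg)).mp hc

lemma isDWRing_of_forall_isWFPProjective (h : ∀ I : Ideal R, IsWFPProjective R I) : IsDWRing R :=
  isDWRing_iff_forall_isGVIdeal_eq_top.mpr fun J hJ ↦
    have := Module.Finite.of_fg hJ.1
    have := (h J).isFPProjective.finitePresentation
    hJ.eq_top_of_extVanishes fun T _ _ hT ↦ h J T (hJ.isAbsolutelyWPure hT)

end DWRing

section Dimension

lemma wfpd_le_iff {M : Type u} [AddCommGroup M] [Module R M] {n : ℕ} :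
    wfpd R M ≤ n ↔ ∃ m ≤ n, ∀ (A : Type u) [AddCommGroup A] [Module R A],
      IsAbsolutelyWPure R A → ExtVanishes R M A (m + 1) := by
  constructor
  · intro h
    obtain ⟨_, ⟨m, rfl, hm⟩, hmn⟩ := sInf_lt_iff.mp (h.trans_lt (Nat.cast_lt.mpr n.lt_succ_self))
    exact ⟨m, Nat.lt_succ_iff.mp (Nat.cast_lt.mp hmn), hm⟩
  · rintro ⟨m, hmn, hm⟩
    exact sInf_le_of_le (b := (m : ℕ∞)) ⟨m, rfl, hm⟩ (Nat.cast_le.mpr hmn)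

/- Vanishing of `Ext^(m+1)` is not obviously monotone in `m`, so one cannot simply take the largest
degree; instead a product of one bad cyclic module for each `m ≤ n` would have dimension `> n`. -/
lemma exists_le_forall_extVanishes_of_wfpD_le {n : ℕ} (h : wfpD R ≤ n) :
    ∃ m ≤ n, ∀ (I : Ideal R) (A : Type u) [AddCommGroup A] [Module R A],
      IsAbsolutelyWPure R A → ExtVanishes R (R ⧸ I) A (m + 1) := by
  by_contra hne
  have hbad (m : Fin (n + 1)) : ∃ I : Ideal R, ¬ ∀ (A : Type u) [AddCommGroup A] [Module R A],
      IsAbsolutelyWPure R A → ExtVanishes R (R ⧸ I) A (m + 1) :=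
    not_forall.mp fun hm ↦ hne ⟨m, m.is_le, hm⟩
  choose I hI using hbad
  have hpi : wfpd R (∀ m, R ⧸ I m) ≤ n :=
    iSup₂_le_iff.mp h (ModuleCat.of R (∀ m, R ⧸ I m)) inferInstance
  obtain ⟨m, hmn, hm⟩ := wfpd_le_iff.mp hpi
  exact hI ⟨m, Nat.lt_succ_of_le hmn⟩ fun A _ _ hA ↦
    (hm A hA).of_comp_eq_id (LinearMap.proj_comp_single_same R _ _)

lemma wfpD_le_iff {n : ℕ} :
    wfpD R ≤ n ↔ ∀ (A : Type u) [AddCommGroup A] [Module R A], IsAbsolutelyWPure R A →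
      injectiveDimension (ModuleCat.of R A) ≤ n := by
  constructor
  · intro h A _ _ hA
    obtain ⟨m, hmn, hm⟩ := exists_le_forall_extVanishes_of_wfpD_le h
    exact ((injectiveDimension_le_iff _ m).mpr
      (hasInjectiveDimensionLE_of_subsingleton_ext fun I ↦ hm I A hA)).trans (by exact_mod_cast hmn)
  · exact fun h ↦ iSup₂_le fun M _ ↦ wfpd_le_iff.mpr ⟨n, le_rfl, fun A _ _ hA ↦
      extVanishes_of_injectiveDimension_le (h A hA) n.lt_succ_self⟩

end Dimension

end WFP


theorem mainTheorem4 (R : Type u) [CommRing R] :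
    List.TFAE [
      WFP.wfpD R ≤ 1,
      ∀ (M : Type u) [AddCommGroup M] [Module R M], WFP.IsWFPProjective R M →
        ∀ N : Submodule R M, WFP.IsWFPProjective R N,
      ∀ (P : Type u) [AddCommGroup P] [Module R P], Module.Projective R P →
        ∀ N : Submodule R P, WFP.IsWFPProjective R N,
      ∀ I : Ideal R, WFP.IsWFPProjective R I,
      ∀ (A : Type u) [AddCommGroup A] [Module R A], WFP.IsAbsolutelyWPure R A →
        injectiveDimension (ModuleCat.of R A) ≤ 1,
      WFP.IsFPHereditary R ∧ WFP.IsDWRing R,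
      WFP.IsCoherentRing R ∧ WFP.IsFPHereditary R ∧ WFP.IsDWRing R] := by
  tfae_have 1 ↔ 5 := WFP.wfpD_le_iff
  tfae_have 5 → 2 := fun h M _ _ hM N A _ _ hA ↦
    (hM A hA).submodule (WFP.extVanishes_of_injectiveDimension_le (h A hA) one_lt_two)
  tfae_have 2 → 3 := fun h P _ _ _ ↦ h P fun A _ _ _ ↦ WFP.extVanishes_succ_of_projective
  tfae_have 3 → 4 := fun h ↦ h R inferInstance
  tfae_have 4 → 5 := fun h A _ _ hA ↦ (injectiveDimension_le_iff _ 1).mpr <|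
    WFP.hasInjectiveDimensionLE_of_subsingleton_ext fun I ↦
      WFP.extVanishes_succ_of_projective.quotient (h I A hA)
  tfae_have 4 → 7 := fun h ↦
    have hR : WFP.IsFPHereditary R := fun I ↦ (h I).isFPProjective
    ⟨hR.isCoherentRing, hR, WFP.isDWRing_of_forall_isWFPProjective h⟩
  tfae_have 7 → 6 := And.right
  tfae_have 6 → 4 := fun ⟨hFP, hDW⟩ I ↦ hDW.isWFPProjective (hFP I)
  tfae_finish
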